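/- Fix a welfare weight $\lambda\in(0,1)$. In each round $i=1,\dots,T$ an individual with willingness to pay $v_i\in[0,1]$ faces a tax rate $x_i\in[0,1]$; social welfare of the rate $x$ in round $i$ is $$U_i(x)=x\cdot\mathbf 1(x\le v_i)+\lambda\max(v_i-x,0),$$ and only $y_i=\mathbf 1(x_i\le v_i)$ is observed. A randomized algorithm chooses $x_i=\alpha_i(w_1,\dots,w_i,y_1,\dots,y_{i-1})$ with measurable functions $\alpha_i$ valued in $[0,1]$ and i.i.d. randomization seeds $w_1,w_2,\dots$, uniform on $[0,1]$. For a set $X\subseteq[0,1]$ of comparison rates, the adversarial regret for a sequence $v=(v_1,\dots,v_T)\in[0,1]^T$ is $$R_T(v;X)=\sup_{x\in X}E\Big[\sum_{i\le T}U_i(x)-\sum_{i\le T}U_i(x_i)\Big],$$ with expectation over the seeds; the stochastic regret $R_T(\mu;X)$ for a probability distribution $\mu$ on $[0,1]$ is given by the same formula, with expectation over the seeds and over $v_1,\dots,v_T$ i.i.d. with law $\mu$, independent of the seeds. Let $G=\{\tfrac14,\tfrac12,\tfrac34,1\}$, $$a=\frac{(1-\lambda)(136-99\lambda)}{2(4-3\lambda)(24-17\lambda)},\qquad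 b=\frac{1-\lambda}{2(24-17\lambda)},$$ and for $\epsilon\in[-1,1]$ let $\mu^\epsilon$ be the probability distribution with masses $a,\ (1+\epsilon)b,\ (1-\epsilon)b,\ 1-a-2b$ at $\tfrac14,\tfrac12,\tfrac34,1$. Theorem. There is a constant $C>0$ (depending only on $\lambda$) such that for every randomized algorithm and every horizon $T\in\mathbb N$: 1. there is a distribution $\mu$ on $[0,1]$, which can be taken to be $\mu^\epsilon$ for some $\epsilon\in[-1,1]$, with $R_T(\mu;[0,1])\ge C\,T^{2/3}$ and even $R_T(\mu;G)\ge C\,T^{2/3}$; 2. there is a sequence $v=(v_1,\dots,v_T)$, which can be taken in $G^T$, with $R_T(v;[0,1])\ge C\,T^{2/3}$ and even $R_T(v;G)\ge C\,T^{2/3}$. In particular the $T^{2/3}$ lower bound persists when both the willingness to pay and the tax rates are restricted to the finite, known set $G$. -/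

import Mathlib

open MeasureTheory

noncomputable section

namespace OptimalTax

/-- A randomized algorithm for the choice of tax rates in `[0,1]`. In round `i` (counted from `0`)
the tax rate is a measurable function of the randomization seeds of rounds `0, …, i` and of the
binary feedback of rounds `0, …, i - 1`. -/
structure RandomizedAlgorithm where
  choice : (i : ℕ) → (Fin (i + 1) → unitInterval) → (Fin i → Bool) → unitInterval
  measurable_choice : ∀ i : ℕ, Measurable
    (fun p : (Fin (i + 1) → unitInterval) × (Fin i → Bool) => choice i p.1 p.2)

namespace RandomizedAlgorithm

/-- The feedback of the first `i` rounds (of `T`), when the seeds are `w` and the willingness to pay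
is `v`: in each round, the individual accepts iff the tax rate is at most the willingness to pay. -/
def feedback (A : RandomizedAlgorithm) {T : ℕ} (w v : Fin T → unitInterval) :
    (i : ℕ) → i ≤ T → Fin i → Bool
  | 0, _ => Fin.elim0
  | i + 1, h => Fin.snoc (α := fun _ => Bool) (A.feedback w v i (Nat.le_of_succ_le h))
      (decide (A.choice i (fun j => w (j.castLE h)) (A.feedback w v i (Nat.le_of_succ_le h))
        ≤ v ⟨i, h⟩))

/-- The tax rate `x_i` chosen in round `i`, given the seeds `w` and the willingness to pay `v`. -/
def policy (A : RandomizedAlgorithm) {T : ℕ} (w v : Fin T → unitInterval) (i : Fin T) :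
    unitInterval :=
  A.choice i (fun j => w (j.castLE i.isLt)) (A.feedback w v i i.isLt.le)

end RandomizedAlgorithm

/-- Social welfare of the tax rate `x` for an individual with willingness to pay `v`:
public revenue plus `lam` times private welfare. -/
def welfare (lam : ℝ) (x v : unitInterval) : ℝ :=
  (x : ℝ) * (if x ≤ v then 1 else 0) + lam * max ((v : ℝ) - x) 0

/-- Cumulative welfare of the constant tax rate `x` minus cumulative welfare of the algorithm. -/
def welfareGap (lam : ℝ) (A : RandomizedAlgorithm) {T : ℕ} (x : unitInterval)
    (w v : Fin T → unitInterval) : ℝ :=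
  ∑ i : Fin T, welfare lam x (v i) - ∑ i : Fin T, welfare lam (A.policy w v i) (v i)

/-- The law of the seeds of `T` rounds: independent and uniform on `[0,1]`. -/
def seedLaw (T : ℕ) : Measure (Fin T → unitInterval) :=
  Measure.pi (fun _ : Fin T => (volume : Measure unitInterval))

/-- Adversarial cumulative expected regret for the sequence `v`, relative to the best constant
tax rate in the set `X`. -/
def adversarialRegret (lam : ℝ) (A : RandomizedAlgorithm) {T : ℕ} (v : Fin T → unitInterval)
    (X : Set unitInterval) : ℝ :=
  ⨆ x : X, ∫ w, welfareGap lam A x w v ∂(seedLaw T)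

/-- Stochastic cumulative expected regret over `T` rounds, when the willingness to pay is i.i.d.
with law `μ` and independent of the seeds, relative to the best constant tax rate in `X`. -/
def stochasticRegret (lam : ℝ) (A : RandomizedAlgorithm) (T : ℕ) (μ : Measure unitInterval)
    (X : Set unitInterval) : ℝ :=
  ⨆ x : X, ∫ p : (Fin T → unitInterval) × (Fin T → unitInterval),
    welfareGap lam A x p.1 p.2 ∂((seedLaw T).prod (Measure.pi (fun _ : Fin T => μ)))

def quarter : unitInterval := ⟨1 / 4, by norm_num, by norm_num⟩
def half : unitInterval := ⟨1 / 2, by norm_num, by norm_num⟩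
def threeQuarters : unitInterval := ⟨3 / 4, by norm_num, by norm_num⟩

/-- The four points `1/4, 1/2, 3/4, 1`. -/
def grid : Set unitInterval := {quarter, half, threeQuarters, 1}

def massA (lam : ℝ) : ℝ :=
  (1 - lam) * (136 - 99 * lam) / (2 * (4 - 3 * lam) * (24 - 17 * lam))

def massB (lam : ℝ) : ℝ :=
  (1 - lam) / (2 * (24 - 17 * lam))

/-- The distribution with masses `a, (1 + ε) b, (1 - ε) b, 1 - a - 2 b` at `1/4, 1/2, 3/4, 1`. -/
def fourPointLaw (lam ε : ℝ) : Measure unitInterval :=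
  ENNReal.ofReal (massA lam) • Measure.dirac quarter
    + ENNReal.ofReal ((1 + ε) * massB lam) • Measure.dirac half
    + ENNReal.ofReal ((1 - ε) * massB lam) • Measure.dirac threeQuarters
    + ENNReal.ofReal (1 - massA lam - 2 * massB lam) • Measure.dirac 1

end OptimalTax

end

noncomputable section

namespace OptimalTax

/-! The welfare of the rate `1/4` contains the private surplus of everyone above it, hence depends
on demand throughout `[1/4, 1]`. Moving mass `ε b` from `3/4` to `1/2` lowers that surplus by a
multiple of `ε`, but changes acceptance probabilities only for rates in `(1/2, 3/4]`. The masses are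
tuned so that `1/4` and `1` tie at `ε = 0`, the sign of `ε` decides which is better, and `1/2` and
`3/4` are worse by a constant (`meanWelfare_mass`, `meanWelfare_mass_sub`). Learning the sign
therefore requires costly rates.

Let `N` be the expected number of rates in `(1/2, 3/4]` under `ε = 0`, and `K` the information
constant. If `N ≥ T^(2/3) / (4K)`, the regret at `ε = 0` is already of order `T^(2/3)`. Otherwise
take `ε = ±η` with `η = T^(-1/3)`: each history carries information at most `η² K N ≤ 1/4`, so the
algorithm behaves similarly under `0` and `±η` (`rounds_zero_le`). For one sign it is wrong in at
least `T/8` expected rounds, each losing at least a multiple of `η`, which gives order `η T =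
T^(2/3)`.

The adversarial bound follows by averaging: for the same comparison rate, some grid sequence has at
least the expected gap (`exists_le_integral_seeds`). -/

/-- The points of `grid`, in increasing order. -/
def gridPoint : Fin 4 → unitInterval := ![quarter, half, threeQuarters, 1]

/-- The masses of `fourPointLaw`. -/
def mass (lam ε : ℝ) : Fin 4 → ℝ :=
  ![massA lam, (1 + ε) * massB lam, (1 - ε) * massB lam, 1 - massA lam - 2 * massB lam]

/-- The feedback history of a deterministic strategy over the first `i` rounds. -/
def history (act : (i : ℕ) → (Fin i → Bool) → unitInterval) :
    (i : ℕ) → (Fin i → unitInterval) → Fin i → Bool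
  | 0, _ => Fin.elim0
  | i + 1, v => Fin.snoc (α := fun _ => Bool) (history act i (Fin.init v))
      (decide (act i (history act i (Fin.init v)) ≤ v (Fin.last i)))

/-- The expectation of a function of the feedback history of a deterministic strategy, when the rate
`x` is accepted with probability `p x`. -/
def histExp (p : unitInterval → ℝ) (act : (i : ℕ) → (Fin i → Bool) → unitInterval) :
    (i : ℕ) → ((Fin i → Bool) → ℝ) → ℝ
  | 0, F => F Fin.elim0
  | i + 1, F => histExp p act i fun h =>
      p (act i h) * F (Fin.snoc (α := fun _ => Bool) h true)
        + (1 - p (act i h)) * F (Fin.snoc (α := fun _ => Bool) h false)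

/-- The probability that the rate `x` is accepted. -/
def demand (m : Fin 4 → ℝ) (x : unitInterval) : ℝ :=
  ∑ κ, m κ * if x ≤ gridPoint κ then 1 else 0

/-- The expected welfare of the rate `x`. -/
def meanWelfare (lam : ℝ) (m : Fin 4 → ℝ) (x : unitInterval) : ℝ :=
  ∑ κ, m κ * welfare lam x (gridPoint κ)

/-- The deterministic strategy that results from fixing the seeds. -/
def RandomizedAlgorithm.strategy (A : RandomizedAlgorithm) {T : ℕ} (w : Fin T → unitInterval)
    (i : ℕ) (h : Fin i → Bool) : unitInterval :=
  A.choice i (fun j => if hj : (j : ℕ) < T then w ⟨j, hj⟩ else 0) h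

/-! ### Change of measure for feedback histories. -/

section histExp

variable {p q : unitInterval → ℝ} {act : (i : ℕ) → (Fin i → Bool) → unitInterval}

lemma histExp_mono (hp0 : ∀ x, 0 ≤ p x) (hp1 : ∀ x, p x ≤ 1) (i : ℕ)
    {F G : (Fin i → Bool) → ℝ} (h : ∀ y, F y ≤ G y) : histExp p act i F ≤ histExp p act i G := by
  induction i with
  | zero => exact h _
  | succ i ih =>
    refine ih fun y => ?_
    exact add_le_add (mul_le_mul_of_nonneg_left (h _) (hp0 _))
      (mul_le_mul_of_nonneg_left (h _) (sub_nonneg.2 (hp1 _)))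

lemma histExp_const (i : ℕ) (c : ℝ) : histExp p act i (fun _ => c) = c := by
  induction i with
  | zero => rfl
  | succ i ih => rw [← ih]; simp only [histExp]; congr 1; ext y; rw [ih]; ring

lemma histExp_add (i : ℕ) (F G : (Fin i → Bool) → ℝ) :
    histExp p act i (fun y => F y + G y) = histExp p act i F + histExp p act i G := by
  induction i with
  | zero => rfl
  | succ i ih => simp only [histExp]; rw [← ih]; congr 1; ext y; ring

lemma histExp_const_mul (i : ℕ) (c : ℝ) (F : (Fin i → Bool) → ℝ) :
    histExp p act i (fun y => c * F y) = c * histExp p act i F := by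
  induction i with
  | zero => rfl
  | succ i ih => simp only [histExp]; rw [← ih]; congr 1; ext y; ring

/-- Gibbs' inequality for one biased coin, with relative entropy weakened to the chi-square
divergence. The case `p = q` stands apart because it includes `p = q = 1`, where that quotient
degenerates; there Jensen suffices. -/
lemma exp_mean_le {p q f g K : ℝ} (hp0 : 0 ≤ p) (hp1 : p ≤ 1) (hq0 : 0 ≤ q) (hq1 : q ≤ 1)
    (hK : (p = q ∧ K = 0) ∨
      (0 < p ∧ p < 1 ∧ 0 < q ∧ q < 1 ∧ (p - q) ^ 2 / (q * (1 - q)) ≤ K)) :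
    p * f + (1 - p) * g - K ≤ Real.log (q * Real.exp f + (1 - q) * Real.exp g) := by
  have hZ : 0 < q * Real.exp f + (1 - q) * Real.exp g := by
    rcases hq0.eq_or_lt with h | h
    · rw [← h]; simp [Real.exp_pos]
    · have := Real.exp_pos f
      have := mul_nonneg (sub_nonneg.2 hq1) (Real.exp_pos g).le
      positivity
  rcases hK with ⟨rfl, rfl⟩ | ⟨h0, h1, h2, h3, hK⟩
  · rw [Real.le_log_iff_exp_le hZ, sub_zero]
    have := convexOn_exp.2 (Set.mem_univ f) (Set.mem_univ g) hp0 (sub_nonneg.2 hp1) (by ring)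
    simpa using this
  · set Z := q * Real.exp f + (1 - q) * Real.exp g
    have h1' : 0 < 1 - p := by linarith
    have h3' : 0 < 1 - q := by linarith
    -- `log t ≤ t - 1` compares `p` with the tilted probabilities `q e^f / Z` and `(1 - q) e^g / Z`;
    -- these sum to `1`, so the right-hand sides of `e1` and `e2` average to zero (`s1`). The bounds
    -- `e3`, `e4` produce the chi-square term (`s2`).
    have e1 : f - Real.log Z + Real.log (q / p) ≤ q * Real.exp f / (Z * p) - 1 := by
      have := Real.log_le_sub_one_of_pos (x := q * Real.exp f / (Z * p)) (by positivity)
      rw [show q * Real.exp f / (Z * p) = q / p * Real.exp f / Z by field_simp,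
        Real.log_div (by positivity) (by positivity),
        Real.log_mul (by positivity) (by positivity), Real.log_exp] at this
      rw [show q * Real.exp f / (Z * p) = q / p * Real.exp f / Z by field_simp]
      linarith
    have e2 : g - Real.log Z + Real.log ((1 - q) / (1 - p))
        ≤ (1 - q) * Real.exp g / (Z * (1 - p)) - 1 := by
      have := Real.log_le_sub_one_of_pos (x := (1 - q) * Real.exp g / (Z * (1 - p)))
        (by positivity)
      have e : (1 - q) * Real.exp g / (Z * (1 - p)) = (1 - q) / (1 - p) * Real.exp g / Z := by
        field_simp
      rw [e, Real.log_div (by positivity) (by positivity),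
        Real.log_mul (by positivity) (by positivity), Real.log_exp] at this
      rw [e]
      linarith
    have e3 : -Real.log (q / p) ≤ p / q - 1 := by
      rw [← Real.log_inv, inv_div]
      exact Real.log_le_sub_one_of_pos (by positivity)
    have e4 : -Real.log ((1 - q) / (1 - p)) ≤ (1 - p) / (1 - q) - 1 := by
      rw [← Real.log_inv, inv_div]
      exact Real.log_le_sub_one_of_pos (by positivity)
    have k1 := mul_le_mul_of_nonneg_left (add_le_add e1 e3) h0.le
    have k2 := mul_le_mul_of_nonneg_left (add_le_add e2 e4) h1'.le
    have s1 : p * (q * Real.exp f / (Z * p)) + (1 - p) * ((1 - q) * Real.exp g / (Z * (1 - p)))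
        = 1 := by
      have : p * (q * Real.exp f / (Z * p)) + (1 - p) * ((1 - q) * Real.exp g / (Z * (1 - p)))
        = Z / Z := by
        simp only [Z]; field_simp
      rw [this, div_self hZ.ne']
    have s2 : p * (p / q) + (1 - p) * ((1 - p) / (1 - q)) - 1 = (p - q) ^ 2 / (q * (1 - q)) := by
      field_simp; ring
    linarith

/-- Gibbs' variational inequality for feedback histories. -/
lemma histExp_sub_le_log (hp0 : ∀ x, 0 ≤ p x) (hp1 : ∀ x, p x ≤ 1) (hq0 : ∀ x, 0 ≤ q x)
    (hq1 : ∀ x, q x ≤ 1) {κ : unitInterval → ℝ}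
    (hκ : ∀ x, (p x = q x ∧ κ x = 0) ∨ (0 < p x ∧ p x < 1 ∧ 0 < q x ∧ q x < 1 ∧
      (p x - q x) ^ 2 / (q x * (1 - q x)) ≤ κ x)) (i : ℕ) (F : (Fin i → Bool) → ℝ) :
    histExp p act i F - ∑ j ∈ Finset.range i, histExp p act j (fun h => κ (act j h))
      ≤ Real.log (histExp q act i (fun h => Real.exp (F h))) := by
  induction i with
  | zero => simp [histExp]
  | succ i ih =>
    have hZ : ∀ (t f g : ℝ), 0 ≤ t → t ≤ 1 → 0 < t * Real.exp f + (1 - t) * Real.exp g := by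
      intro t f g h0 h1
      rcases h0.eq_or_lt with h | h
      · rw [← h]; simp [Real.exp_pos]
      · have := Real.exp_pos f
        have := mul_nonneg (sub_nonneg.2 h1) (Real.exp_pos g).le
        positivity
    -- The last round is integrated out: the log of the conditional exponential moment under `q`
    -- serves as the new function, and its exponential restores the full moment.
    have key := ih fun h => Real.log
      (q (act i h) * Real.exp (F (Fin.snoc (α := fun _ => Bool) h true))
        + (1 - q (act i h)) * Real.exp (F (Fin.snoc (α := fun _ => Bool) h false)))
    simp only [Real.exp_log (hZ _ _ _ (hq0 _) (hq1 _))] at key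
    refine le_trans ?_ key
    rw [Finset.sum_range_succ]
    have step : histExp p act (i + 1) F ≤ histExp p act i (fun h => Real.log
      (q (act i h) * Real.exp (F (Fin.snoc (α := fun _ => Bool) h true))
        + (1 - q (act i h)) * Real.exp (F (Fin.snoc (α := fun _ => Bool) h false))))
        + histExp p act i (fun h => κ (act i h)) := by
      rw [← histExp_add]
      refine histExp_mono hp0 hp1 i fun h => ?_
      have := exp_mean_le (f := F (Fin.snoc (α := fun _ => Bool) h true))
        (g := F (Fin.snoc (α := fun _ => Bool) h false))
        (hp0 (act i h)) (hp1 (act i h)) (hq0 (act i h)) (hq1 (act i h)) (hκ (act i h))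
      linarith
    linarith

/-- Change of measure for functions with values in `[0,1]`. -/
lemma histExp_sub_le_two_mul (hp0 : ∀ x, 0 ≤ p x) (hp1 : ∀ x, p x ≤ 1) (hq0 : ∀ x, 0 ≤ q x)
    (hq1 : ∀ x, q x ≤ 1) {κ : unitInterval → ℝ}
    (hκ : ∀ x, (p x = q x ∧ κ x = 0) ∨ (0 < p x ∧ p x < 1 ∧ 0 < q x ∧ q x < 1 ∧
      (p x - q x) ^ 2 / (q x * (1 - q x)) ≤ κ x)) (i : ℕ) {F : (Fin i → Bool) → ℝ}
    (hF0 : ∀ h, 0 ≤ F h) (hF1 : ∀ h, F h ≤ 1) :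
    histExp p act i F - ∑ j ∈ Finset.range i, histExp p act j (fun h => κ (act j h))
      ≤ 2 * histExp q act i F := by
  refine (histExp_sub_le_log hp0 hp1 hq0 hq1 hκ i F).trans ?_
  -- The chord of `exp` over `[0,1]` gives `e^F ≤ 1 + (e - 1) F`, and `e - 1 ≤ 2`.
  have h1 : histExp q act i (fun h => Real.exp (F h)) ≤ 1 + 2 * histExp q act i F := by
    rw [← histExp_const_mul, ← histExp_const (p := q) (act := act) i 1, ← histExp_add]
    refine histExp_mono hq0 hq1 i fun h => ?_
    have := convexOn_exp.2 (Set.mem_univ 0) (Set.mem_univ 1) (sub_nonneg.2 (hF1 h)) (hF0 h)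
      (by ring)
    simp only [smul_eq_mul, mul_zero, mul_one, zero_add, Real.exp_zero] at this
    have := Real.exp_one_lt_d9
    nlinarith [hF0 h]
  have h0 : 1 ≤ histExp q act i (fun h => Real.exp (F h)) := by
    rw [← histExp_const (p := q) (act := act) i 1]
    refine histExp_mono hq0 hq1 i fun h => ?_
    simpa using hF0 h
  have := Real.log_le_sub_one_of_pos (zero_lt_one.trans_le h0)
  linarith

end histExp

/-! ### Averages over i.i.d. grid sequences as history expectations. -/

section finiteSums

variable {K : Type*} [Fintype K]

lemma sum_prod_snoc (m : K → ℝ) (i : ℕ) (F : (Fin (i + 1) → K) → ℝ) :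
    ∑ k : Fin (i + 1) → K, (∏ j, m (k j)) * F k
      = ∑ k : Fin i → K, (∏ j, m (k j)) * ∑ κ, m κ * F (Fin.snoc (α := fun _ => K) k κ) := by
  rw [← (Fin.snocEquiv fun _ : Fin (i + 1) => K).sum_comp, Fintype.sum_prod_type_right]
  refine Finset.sum_congr rfl fun k _ => ?_
  rw [Finset.mul_sum]
  refine Finset.sum_congr rfl fun κ _ => ?_
  simp [Fin.snocEquiv, Fin.prod_univ_castSucc, mul_assoc]

lemma sum_prod_castLE {m : K → ℝ} (hm : ∑ κ, m κ = 1) {i T : ℕ} (h : i ≤ T)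
    (F : (Fin i → K) → ℝ) :
    ∑ k : Fin T → K, (∏ j, m (k j)) * F (fun j => k (j.castLE h))
      = ∑ k : Fin i → K, (∏ j, m (k j)) * F k := by
  induction T, h using Nat.le_induction with
  | base => rfl
  | succ T hT ih =>
    rw [sum_prod_snoc, ← ih]
    refine Finset.sum_congr rfl fun k _ => ?_
    have : ∀ κ, (fun j : Fin i => Fin.snoc (α := fun _ => K) k κ (j.castLE (hT.trans T.le_succ)))
        = fun j => k (j.castLE hT) := by
      intro κ
      ext j
      exact Fin.snoc_castSucc (α := fun _ => K) κ k (j.castLE hT)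
    simp only [this]
    rw [← Finset.sum_mul, hm, one_mul]

end finiteSums

lemma demand_add_rejection {m : Fin 4 → ℝ} (hm : ∑ κ, m κ = 1) (x : unitInterval) (f g : ℝ) :
    ∑ κ, m κ * (if x ≤ gridPoint κ then f else g) = demand m x * f + (1 - demand m x) * g := by
  rw [← hm, demand, ← Finset.sum_sub_distrib, Finset.sum_mul, Finset.sum_mul,
    ← Finset.sum_add_distrib]
  refine Finset.sum_congr rfl fun κ _ => ?_
  split_ifs <;> ring

/-- The history sees each valuation only through an acceptance bit, so the masses enter only through
`demand`. -/
lemma sum_prod_history {m : Fin 4 → ℝ} (hm : ∑ κ, m κ = 1)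
    (act : (i : ℕ) → (Fin i → Bool) → unitInterval) (i : ℕ) (F : (Fin i → Bool) → ℝ) :
    ∑ k : Fin i → Fin 4, (∏ j, m (k j)) * F (history act i (fun j => gridPoint (k j)))
      = histExp (demand m) act i F := by
  induction i with
  | zero => simp [histExp, history]
  | succ i ih =>
    rw [sum_prod_snoc]
    simp only [histExp]
    rw [← ih]
    refine Finset.sum_congr rfl fun k _ => ?_
    rw [← demand_add_rejection hm]
    congr 1
    refine Finset.sum_congr rfl fun κ _ => ?_
    have : (Fin.init fun j : Fin (i + 1) => gridPoint (Fin.snoc (α := fun _ => Fin 4) k κ j))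
        = fun j => gridPoint (k j) := by
      ext j; simp [Fin.init]
    simp only [history, this, Fin.snoc_last]
    split_ifs with h <;> simp [h]

lemma sum_prod_history_apply {m : Fin 4 → ℝ} (hm : ∑ κ, m κ = 1)
    (act : (i : ℕ) → (Fin i → Bool) → unitInterval) {i T : ℕ} (hi : i < T)
    (F : (Fin i → Bool) → Fin 4 → ℝ) :
    ∑ k : Fin T → Fin 4, (∏ j, m (k j)) *
        F (history act i (fun j => gridPoint (k (j.castLE hi.le)))) (k ⟨i, hi⟩)
      = histExp (demand m) act i (fun h => ∑ κ, m κ * F h κ) := by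
  have := sum_prod_castLE hm (Nat.succ_le_of_lt hi) (fun k : Fin (i + 1) → Fin 4 =>
    F (history act i (fun j => gridPoint (k j.castSucc))) (k (Fin.last i)))
  refine Eq.trans ?_ (this.trans ?_)
  · rfl
  · rw [sum_prod_snoc, ← sum_prod_history hm]
    simp

lemma RandomizedAlgorithm.feedback_eq_history (A : RandomizedAlgorithm) {T : ℕ}
    (w v : Fin T → unitInterval) (i : ℕ) (hi : i ≤ T) :
    A.feedback w v i hi = history (A.strategy w) i (fun j => v (j.castLE hi)) := by
  induction i with
  | zero => rfl
  | succ i ih =>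
    have hs : ∀ h, A.strategy w i h = A.choice i (fun j => w (j.castLE hi)) h := by
      intro h
      unfold RandomizedAlgorithm.strategy
      congr 1
      ext j
      rw [dif_pos (j.isLt.trans_le hi)]
      rfl
    rw [RandomizedAlgorithm.feedback, history, hs]
    have : (Fin.init fun j : Fin (i + 1) => v (j.castLE hi))
        = fun j => v (j.castLE (Nat.le_of_succ_le hi)) := rfl
    rw [this, ← ih]
    rfl

lemma RandomizedAlgorithm.policy_eq_strategy (A : RandomizedAlgorithm) {T : ℕ}
    (w v : Fin T → unitInterval) (i : Fin T) :
    A.policy w v i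
      = A.strategy w i (history (A.strategy w) i (fun j => v (j.castLE i.isLt.le))) := by
  rw [RandomizedAlgorithm.policy, A.feedback_eq_history, RandomizedAlgorithm.strategy]
  congr 1
  ext j
  rw [dif_pos (j.isLt.trans_le i.isLt)]
  rfl

/-- For fixed seeds, the expected welfare gap is the expected sum of instantaneous losses. -/
lemma sum_prod_welfareGap {m : Fin 4 → ℝ} (hm : ∑ κ, m κ = 1) (lam : ℝ)
    (A : RandomizedAlgorithm) {T : ℕ} (x : unitInterval) (w : Fin T → unitInterval) :
    ∑ k : Fin T → Fin 4, (∏ j, m (k j)) * welfareGap lam A x w (fun j => gridPoint (k j))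
      = ∑ i ∈ Finset.range T, histExp (demand m) (A.strategy w) i
          (fun h => meanWelfare lam m x - meanWelfare lam m (A.strategy w i h)) := by
  rw [← Fin.sum_univ_eq_sum_range (fun i => histExp (demand m) (A.strategy w) i
          (fun h => meanWelfare lam m x - meanWelfare lam m (A.strategy w i h)))]
  simp only [welfareGap, ← Finset.sum_sub_distrib, Finset.mul_sum]
  rw [Finset.sum_comm]
  refine Finset.sum_congr rfl fun i _ => ?_
  have := sum_prod_history_apply hm (A.strategy w) i.isLt (fun h κ =>
    welfare lam x (gridPoint κ) - welfare lam (A.strategy w i h) (gridPoint κ))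
  simp only [A.policy_eq_strategy]
  refine this.trans ?_
  congr 1
  ext h
  simp only [meanWelfare, ← Finset.sum_sub_distrib, mul_sub]

/-! ### Rounding rates up to the grid. -/

/-- The index of the least grid point that is at least `x`. -/
def ceilIdx (x : unitInterval) : Fin 4 :=
  if x ≤ quarter then 0 else if x ≤ half then 1 else if x ≤ threeQuarters then 2 else 3

lemma le_gridPoint_ceilIdx (x : unitInterval) : x ≤ gridPoint (ceilIdx x) := by
  unfold ceilIdx
  split_ifs with h1 h2 h3
  · exact h1
  · exact h2
  · exact h3
  · exact unitInterval.le_one'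

lemma strictMono_gridPoint : StrictMono gridPoint := by
  rw [Fin.strictMono_iff_lt_succ]
  intro i
  fin_cases i <;> simp [gridPoint, quarter, half, threeQuarters, ← Subtype.coe_lt_coe] <;> norm_num

lemma le_gridPoint_iff (x : unitInterval) (κ : Fin 4) : x ≤ gridPoint κ ↔ ceilIdx x ≤ κ := by
  refine ⟨fun h => ?_, fun h => (le_gridPoint_ceilIdx x).trans (strictMono_gridPoint.monotone h)⟩
  unfold ceilIdx
  fin_cases κ <;> simp only [gridPoint] at h
  · simp [show x ≤ quarter from h]
  · have : x ≤ half := h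
    split_ifs <;> simp
  · have : x ≤ threeQuarters := h
    split_ifs <;> simp
  · split_ifs <;> decide

lemma measurable_ceilIdx : Measurable ceilIdx := by
  unfold ceilIdx
  exact Measurable.ite measurableSet_Iic measurable_const <|
    Measurable.ite measurableSet_Iic measurable_const <|
    Measurable.ite measurableSet_Iic measurable_const measurable_const

lemma gridPoint_mem (κ : Fin 4) : gridPoint κ ∈ grid := by
  fin_cases κ <;> simp [gridPoint, grid]

lemma demand_eq (m : Fin 4 → ℝ) (x : unitInterval) :
    demand m x = ![∑ κ, m κ, m 1 + m 2 + m 3, m 2 + m 3, m 3] (ceilIdx x) := by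
  simp only [demand, le_gridPoint_iff]
  generalize ceilIdx x = j
  fin_cases j <;> simp [Fin.sum_univ_four]

/-- On acceptance the welfare is `(1 - lam) x + lam v`, which increases with the rate; on rejection
it is zero. Hence rounding up to the grid never hurts. -/
lemma welfare_le_welfare {lam : ℝ} (h1 : lam ≤ 1) {x y v : unitInterval} (hxy : x ≤ y)
    (hv : x ≤ v → y ≤ v) : welfare lam x v ≤ welfare lam y v := by
  have hxy' : (x : ℝ) ≤ y := hxy
  unfold welfare
  by_cases hx : x ≤ v
  · have hy := hv hx
    have a : (x : ℝ) ≤ v := hx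
    have b : (y : ℝ) ≤ v := hy
    rw [if_pos hx, if_pos hy, max_eq_left (by linarith), max_eq_left (by linarith)]
    nlinarith
  · have hy : ¬ y ≤ v := fun h => hx (hxy.trans h)
    have a : (v : ℝ) < x := not_le.1 hx
    rw [if_neg hx, if_neg hy, max_eq_right (by linarith), max_eq_right (by linarith)]
    simp

lemma meanWelfare_le {lam : ℝ} (h1 : lam ≤ 1) {m : Fin 4 → ℝ} (hm : ∀ κ, 0 ≤ m κ)
    (x : unitInterval) :
    meanWelfare lam m x ≤ meanWelfare lam m (gridPoint (ceilIdx x)) :=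
  Finset.sum_le_sum fun κ _ => mul_le_mul_of_nonneg_left
    (welfare_le_welfare h1 (le_gridPoint_ceilIdx x) fun h =>
      strictMono_gridPoint.monotone ((le_gridPoint_iff x κ).1 h)) (hm κ)

lemma meanWelfare_gridPoint (lam : ℝ) (m : Fin 4 → ℝ) (j : Fin 4) :
    meanWelfare lam m (gridPoint j) =
      ![1 / 4 * (m 0 + m 1 + m 2 + m 3) + lam * (m 1 / 4 + m 2 / 2 + m 3 * (3 / 4)),
        1 / 2 * (m 1 + m 2 + m 3) + lam * (m 2 / 4 + m 3 / 2),
        3 / 4 * (m 2 + m 3) + lam * (m 3 / 4), m 3] j := by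
  have e : ∀ κ, welfare lam (gridPoint j) (gridPoint κ)
      = gridPoint j * (if j ≤ κ then 1 else 0)
        + lam * max ((gridPoint κ : ℝ) - gridPoint j) 0 := by
    intro κ
    simp only [welfare, strictMono_gridPoint.le_iff_le]
  simp only [meanWelfare, e, Fin.sum_univ_four]
  have g0 : (gridPoint 0 : ℝ) = 1 / 4 := rfl
  have g1 : (gridPoint 1 : ℝ) = 1 / 2 := rfl
  have g2 : (gridPoint 2 : ℝ) = 3 / 4 := rfl
  have g3 : (gridPoint 3 : ℝ) = 1 := rfl
  fin_cases j <;> simp [g0, g1, g2, g3] <;> norm_num <;> ring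

/-! ### Welfare and information under the four-point law. -/

section mass

variable {lam : ℝ}

lemma sum_mass (ε : ℝ) : ∑ κ, mass lam ε κ = 1 := by
  simp [Fin.sum_univ_four, mass]; ring

lemma massA_pos (h0 : 0 < lam) (h1 : lam < 1) : 0 < massA lam := by
  have := sub_pos.2 h1
  have : 0 < 136 - 99 * lam := by linarith
  have : 0 < 4 - 3 * lam := by linarith
  have : 0 < 24 - 17 * lam := by linarith
  unfold massA; positivity

lemma massB_pos (h0 : 0 < lam) (h1 : lam < 1) : 0 < massB lam := by
  have := sub_pos.2 h1
  have : 0 < 24 - 17 * lam := by linarith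
  unfold massB; positivity

/-- At `ε = 0` the rates `1/4` and `1` yield the same expected welfare. -/
lemma mass_three_eq (h0 : 0 < lam) (h1 : lam < 1) :
    1 - massA lam - 2 * massB lam = (1 + 3 * lam * massB lam) / (4 - 3 * lam) := by
  have h4 : 4 - 3 * lam ≠ 0 := by linarith
  have h24 : 24 - 17 * lam ≠ 0 := by linarith
  unfold massA massB
  generalize hD : 4 - 3 * lam = D at *
  generalize hE : 24 - 17 * lam = E at *
  field_simp
  rw [← hD, ← hE]
  ring

lemma mass_three_pos (h0 : 0 < lam) (h1 : lam < 1) : 0 < 1 - massA lam - 2 * massB lam := by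
  have := massB_pos h0 h1
  have : 0 < 4 - 3 * lam := by linarith
  rw [mass_three_eq h0 h1]; positivity

lemma mass_nonneg (h0 : 0 < lam) (h1 : lam < 1) {ε : ℝ} (hε : ε ∈ Set.Icc (-1 : ℝ) 1)
    (κ : Fin 4) : 0 ≤ mass lam ε κ := by
  have ha := massA_pos h0 h1
  have hb := massB_pos h0 h1
  have hc := mass_three_pos h0 h1
  have : 0 ≤ 1 + ε := by linarith [hε.1]
  have : 0 ≤ 1 - ε := by linarith [hε.2]
  fin_cases κ
  · exact ha.le
  · exact mul_nonneg ‹_› hb.le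
  · exact mul_nonneg ‹_› hb.le
  · exact hc.le

/-- The top mass outweighs the middle masses enough for the rate `1` to beat `1/2` and `3/4` by a
constant uniformly in `ε ∈ [-1, 1]`. -/
lemma twelve_mul_massB_le (h0 : 0 < lam) (h1 : lam < 1) :
    12 * massB lam ≤ (1 - lam) * (1 - massA lam - 2 * massB lam) := by
  have hb := massB_pos h0 h1
  have h4 : 0 < 4 - 3 * lam := by linarith
  have h24 : 0 < 24 - 17 * lam := by linarith
  have e : (1 - lam) = massB lam * (2 * (24 - 17 * lam)) := by rw [massB, div_mul_cancel₀ _ (by positivity)]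
  have hc : 1 / (4 - 3 * lam) ≤ 1 - massA lam - 2 * massB lam := by
    rw [mass_three_eq h0 h1]
    gcongr
    have := mul_pos h0 hb
    linarith
  have : 12 ≤ 2 * (24 - 17 * lam) * (1 / (4 - 3 * lam)) := by
    rw [mul_one_div, le_div_iff₀ h4]; linarith
  calc 12 * massB lam ≤ (2 * (24 - 17 * lam) * (1 / (4 - 3 * lam))) * massB lam := by gcongr
    _ = (1 - lam) * (1 / (4 - 3 * lam)) := by
        rw [show (1 - lam) * (1 / (4 - 3 * lam))
          = massB lam * (2 * (24 - 17 * lam)) * (1 / (4 - 3 * lam)) by rw [← e]]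
        ring
    _ ≤ _ := by gcongr

/-- Expected welfare of the grid rates under `mass lam ε`, compared with that of the rate `1`. -/
lemma meanWelfare_mass (h0 : 0 < lam) (h1 : lam < 1) {ε : ℝ} (hε : ε ∈ Set.Icc (-1 : ℝ) 1)
    (j : Fin 4) :
    meanWelfare lam (mass lam ε) (gridPoint 3) - meanWelfare lam (mass lam ε) (gridPoint j)
      ≥ ![lam * massB lam / 4 * ε, lam * massB lam / 4, lam * massB lam / 4, 0] j := by
  have hb := massB_pos h0 h1
  have hc := twelve_mul_massB_le h0 h1
  have e := mass_three_eq h0 h1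
  rw [eq_div_iff (by linarith)] at e
  have hlb := mul_pos h0 hb
  have hlb1 : lam * massB lam ≤ massB lam := by nlinarith
  have k1 : massB lam * ε ≤ massB lam := by nlinarith [hε.2]
  have k2 : -massB lam ≤ massB lam * ε := by nlinarith [hε.1]
  have k3 : lam * massB lam * ε ≤ lam * massB lam := by nlinarith [hε.2]
  have k4 : -(lam * massB lam) ≤ lam * massB lam * ε := by nlinarith [hε.1]
  simp only [meanWelfare_gridPoint]
  have m0 : mass lam ε 0 = massA lam := rfl
  have m1 : mass lam ε 1 = (1 + ε) * massB lam := rfl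
  have m2 : mass lam ε 2 = (1 - ε) * massB lam := rfl
  have m3 : mass lam ε 3 = 1 - massA lam - 2 * massB lam := rfl
  simp only [m0, m1, m2, m3]
  generalize massA lam = a at *
  generalize massB lam = b at *
  fin_cases j <;> simp <;> nlinarith

/-- The comparison of the rates `1` and `1/4` under `mass lam ε`. -/
lemma meanWelfare_mass_sub (h0 : 0 < lam) (h1 : lam < 1) (ε : ℝ) :
    meanWelfare lam (mass lam ε) (gridPoint 3) - meanWelfare lam (mass lam ε) (gridPoint 0)
      = lam * massB lam / 4 * ε := by
  have e := mass_three_eq h0 h1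
  rw [eq_div_iff (by linarith)] at e
  simp only [meanWelfare_gridPoint]
  simp [mass]
  linarith

lemma demand_mass_nonneg (h0 : 0 < lam) (h1 : lam < 1) {ε : ℝ} (hε : ε ∈ Set.Icc (-1 : ℝ) 1)
    (x : unitInterval) : 0 ≤ demand (mass lam ε) x :=
  Finset.sum_nonneg fun κ _ => mul_nonneg (mass_nonneg h0 h1 hε κ) (by split_ifs <;> simp)

lemma demand_mass_le_one (h0 : 0 < lam) (h1 : lam < 1) {ε : ℝ} (hε : ε ∈ Set.Icc (-1 : ℝ) 1)
    (x : unitInterval) : demand (mass lam ε) x ≤ 1 := by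
  rw [← sum_mass (lam := lam) ε]
  exact Finset.sum_le_sum fun κ _ => mul_le_of_le_one_right (mass_nonneg h0 h1 hε κ)
    (by split_ifs <;> simp)

/-- The cost of information: only rates in `(1/2, 3/4]` are informative about `ε`. -/
def infoCost (lam ε : ℝ) (x : unitInterval) : ℝ :=
  ε ^ 2 * (massB lam ^ 2 / (massA lam * (1 - massA lam - 2 * massB lam)))
    * if ceilIdx x = 2 then 1 else 0

/-- The perturbation preserves the joint mass of `1/2` and `3/4`, so only index `2` sees it, with a
change of `ε b`. There the acceptance probability is at least the mass of `1` and the rejection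
probability at least the mass `a` of `1/4`, which bounds the denominator. -/
lemma demand_mass_divergence (h0 : 0 < lam) (h1 : lam < 1) {ε : ℝ}
    (hε : ε ∈ Set.Icc (-1 : ℝ) 1) (x : unitInterval) :
    (demand (mass lam 0) x = demand (mass lam ε) x ∧ infoCost lam ε x = 0) ∨
      (0 < demand (mass lam 0) x ∧ demand (mass lam 0) x < 1 ∧ 0 < demand (mass lam ε) x ∧
        demand (mass lam ε) x < 1 ∧
        (demand (mass lam 0) x - demand (mass lam ε) x) ^ 2
          / (demand (mass lam ε) x * (1 - demand (mass lam ε) x)) ≤ infoCost lam ε x) := by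
  have ha := massA_pos h0 h1
  have hb := massB_pos h0 h1
  have hc := mass_three_pos h0 h1
  simp only [demand_eq, sum_mass, infoCost]
  generalize ceilIdx x = j
  have m1 : ∀ ε, mass lam ε 1 = (1 + ε) * massB lam := fun _ => rfl
  have m2 : ∀ ε, mass lam ε 2 = (1 - ε) * massB lam := fun _ => rfl
  have m3 : ∀ ε, mass lam ε 3 = 1 - massA lam - 2 * massB lam := fun _ => rfl
  simp only [m1, m2, m3]
  have p1 : 0 ≤ (1 - ε) * massB lam := mul_nonneg (by linarith [hε.2]) hb.le
  have p2 : 0 ≤ (1 + ε) * massB lam := mul_nonneg (by linarith [hε.1]) hb.le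
  fin_cases j
  · left; simp
  · left; simp; ring
  · right
    simp only [Fin.reduceFinMk, Matrix.cons_val, if_true, mul_one]
    refine ⟨by linarith, by linarith, by linarith, by linarith, ?_⟩
    rw [← mul_div_assoc, ← mul_pow,
      show (1 - 0) * massB lam + (1 - massA lam - 2 * massB lam)
        - ((1 - ε) * massB lam + (1 - massA lam - 2 * massB lam)) = ε * massB lam by ring,
      mul_comm (massA lam)]
    gcongr <;> linarith
  · left; simp

end mass

/-! ### Integrals against the four-point law as finite sums. -/

/-- The four point law as a law on the indices of the grid points. -/
def indexLaw (lam ε : ℝ) : Measure (Fin 4) :=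
  ∑ κ, ENNReal.ofReal (mass lam ε κ) • Measure.dirac κ

lemma map_indexLaw (lam ε : ℝ) : (indexLaw lam ε).map gridPoint = fourPointLaw lam ε := by
  have h : Measurable gridPoint := measurable_of_countable _
  simp only [indexLaw, Fin.sum_univ_four, Measure.map_add _ _ h, Measure.map_smul,
    Measure.map_dirac' h]
  rfl

lemma indexLaw_singleton (lam ε : ℝ) (κ : Fin 4) :
    indexLaw lam ε {κ} = ENNReal.ofReal (mass lam ε κ) := by
  simp only [indexLaw, Measure.coe_finsetSum, Finset.sum_apply, Measure.smul_apply,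
    Measure.dirac_apply, smul_eq_mul]
  rw [Finset.sum_eq_single κ] <;> simp +contextual

lemma isProbabilityMeasure_indexLaw {lam ε : ℝ} (hm : ∀ κ, 0 ≤ mass lam ε κ) :
    IsProbabilityMeasure (indexLaw lam ε) := by
  refine ⟨?_⟩
  simp only [indexLaw, Measure.coe_finsetSum, Finset.sum_apply, Measure.smul_apply,
    measure_univ, smul_eq_mul, mul_one]
  rw [← ENNReal.ofReal_sum_of_nonneg fun κ _ => hm κ, sum_mass, ENNReal.ofReal_one]

lemma isProbabilityMeasure_fourPointLaw {lam ε : ℝ} (hm : ∀ κ, 0 ≤ mass lam ε κ) :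
    IsProbabilityMeasure (fourPointLaw lam ε) := by
  have := isProbabilityMeasure_indexLaw hm
  rw [← map_indexLaw]
  exact Measure.isProbabilityMeasure_map (measurable_of_countable _).aemeasurable

lemma integral_pi_fourPointLaw {lam ε : ℝ} (hm : ∀ κ, 0 ≤ mass lam ε κ) (T : ℕ)
    {f : (Fin T → unitInterval) → ℝ} (hf : Measurable f) :
    ∫ v, f v ∂(Measure.pi fun _ : Fin T => fourPointLaw lam ε)
      = ∑ k : Fin T → Fin 4, (∏ j, mass lam ε (k j)) * f (fun j => gridPoint (k j)) := by
  have := isProbabilityMeasure_indexLaw hm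
  have hg : Measurable gridPoint := measurable_of_countable _
  have e : (Measure.pi fun _ : Fin T => fourPointLaw lam ε)
      = (Measure.pi fun _ : Fin T => indexLaw lam ε).map (fun k j => gridPoint (k j)) := by
    have := isProbabilityMeasure_fourPointLaw hm
    simp only [← map_indexLaw] at this ⊢
    exact (Measure.pi_map_pi (fun _ => hg.aemeasurable)).symm
  rw [e, integral_map (measurable_of_countable _).aemeasurable hf.aestronglyMeasurable,
    integral_fintype Integrable.of_finite]
  refine Finset.sum_congr rfl fun k _ => ?_
  rw [Measure.real, Measure.pi_singleton, ENNReal.toReal_prod, smul_eq_mul]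
  simp only [indexLaw_singleton, ENNReal.toReal_ofReal (hm _)]

/-! ### Measurability and boundedness. -/

section measurability

lemma measurable_welfare (lam : ℝ) :
    Measurable fun p : unitInterval × unitInterval => welfare lam p.1 p.2 := by
  unfold welfare
  have : Measurable fun p : unitInterval × unitInterval =>
      (if p.1 ≤ p.2 then 1 else 0 : ℝ) :=
    Measurable.ite (measurableSet_le measurable_fst measurable_snd) measurable_const
      measurable_const
  fun_prop

lemma RandomizedAlgorithm.measurable_feedback (A : RandomizedAlgorithm) {T : ℕ} (i : ℕ)
    (hi : i ≤ T) : Measurable fun p : (Fin T → unitInterval) × (Fin T → unitInterval) =>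
      A.feedback p.1 p.2 i hi := by
  induction i with
  | zero => exact measurable_of_subsingleton_codomain _
  | succ i ih =>
    have h := ih (Nat.le_of_succ_le hi)
    have hc : Measurable fun p : (Fin T → unitInterval) × (Fin T → unitInterval) =>
        A.choice i (fun j => p.1 (j.castLE hi)) (A.feedback p.1 p.2 i (Nat.le_of_succ_le hi)) :=
      (A.measurable_choice i).comp (Measurable.prodMk (by fun_prop) h)
    refine measurable_pi_lambda _ fun j => ?_
    refine Fin.lastCases ?_ (fun j => ?_) j
    · simp only [RandomizedAlgorithm.feedback, Fin.snoc_last]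
      refine measurable_to_bool ?_
      have : (fun p : (Fin T → unitInterval) × (Fin T → unitInterval) =>
          decide (A.choice i (fun j => p.1 (j.castLE hi))
            (A.feedback p.1 p.2 i (Nat.le_of_succ_le hi)) ≤ p.2 ⟨i, hi⟩)) ⁻¹' {true}
          = {p | A.choice i (fun j => p.1 (j.castLE hi))
            (A.feedback p.1 p.2 i (Nat.le_of_succ_le hi)) ≤ p.2 ⟨i, hi⟩} := by
        ext p; simp
      rw [this]
      exact measurableSet_le hc (by fun_prop)
    · simp only [RandomizedAlgorithm.feedback, Fin.snoc_castSucc]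
      exact (measurable_pi_apply j).comp h

lemma RandomizedAlgorithm.measurable_policy (A : RandomizedAlgorithm) {T : ℕ} (i : Fin T) :
    Measurable fun p : (Fin T → unitInterval) × (Fin T → unitInterval) =>
      A.policy p.1 p.2 i :=
  (A.measurable_choice i).comp
    (Measurable.prodMk (by fun_prop) (A.measurable_feedback i i.isLt.le))

lemma measurable_welfareGap (lam : ℝ) (A : RandomizedAlgorithm) {T : ℕ} (x : unitInterval) :
    Measurable fun p : (Fin T → unitInterval) × (Fin T → unitInterval) =>
      welfareGap lam A x p.1 p.2 := by
  unfold welfareGap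
  refine Measurable.sub ?_ ?_
  · exact Finset.measurable_sum _ fun i _ => (measurable_welfare lam).comp
      (Measurable.prodMk measurable_const (by fun_prop))
  · exact Finset.measurable_sum _ fun i _ => (measurable_welfare lam).comp
      (Measurable.prodMk (A.measurable_policy i) (by fun_prop))

lemma abs_welfare_le {lam : ℝ} (h0 : 0 ≤ lam) (h1 : lam ≤ 1) (x v : unitInterval) :
    |welfare lam x v| ≤ 2 := by
  have := x.2.1; have := x.2.2; have := v.2.1; have := v.2.2
  have hm0 : 0 ≤ max ((v : ℝ) - x) 0 := le_max_right _ _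
  have hm1 : max ((v : ℝ) - x) 0 ≤ 1 := max_le (by linarith) zero_le_one
  unfold welfare
  rw [abs_le]
  split_ifs <;> constructor <;> nlinarith

lemma abs_welfareGap_le {lam : ℝ} (h0 : 0 ≤ lam) (h1 : lam ≤ 1) (A : RandomizedAlgorithm) {T : ℕ}
    (x : unitInterval) (w v : Fin T → unitInterval) : |welfareGap lam A x w v| ≤ 4 * T := by
  have key : ∀ y : Fin T → unitInterval, |∑ i, welfare lam (y i) (v i)| ≤ T * 2 := fun y => by
    refine (Finset.abs_sum_le_sum_abs _ _).trans
      ((Finset.sum_le_sum fun i _ => abs_welfare_le h0 h1 (y i) (v i)).trans (by simp))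
  have := key fun _ => x
  have := key (A.policy w v)
  refine (abs_sub _ _).trans ?_
  linarith

instance (T : ℕ) : IsProbabilityMeasure (seedLaw T) := by
  unfold seedLaw; infer_instance

lemma integrable_welfareGap {lam : ℝ} (h0 : 0 ≤ lam) (h1 : lam ≤ 1) (A : RandomizedAlgorithm)
    {T : ℕ} (x : unitInterval)
    (μ : Measure ((Fin T → unitInterval) × (Fin T → unitInterval))) [IsFiniteMeasure μ] :
    Integrable (fun p => welfareGap lam A x p.1 p.2) μ :=
  Integrable.of_bound (measurable_welfareGap lam A x).aestronglyMeasurable (4 * T)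
    (Filter.Eventually.of_forall fun p => by
      simpa using abs_welfareGap_le h0 h1 A x p.1 p.2)

lemma RandomizedAlgorithm.measurable_strategy (A : RandomizedAlgorithm) {T : ℕ} (i : ℕ)
    (h : Fin i → Bool) : Measurable fun w : Fin T → unitInterval => A.strategy w i h := by
  refine (A.measurable_choice i).comp (Measurable.prodMk ?_ measurable_const)
  refine measurable_pi_lambda _ fun j => ?_
  change Measurable fun w : Fin T → unitInterval => if hj : (j : ℕ) < T then w ⟨j, hj⟩ else 0
  split_ifs <;> fun_prop

lemma measurable_histExp (A : RandomizedAlgorithm) {T : ℕ} {p : unitInterval → ℝ}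
    (hp : Measurable p) (i : ℕ) {F : (Fin T → unitInterval) → (Fin i → Bool) → ℝ}
    (hF : ∀ h, Measurable fun w => F w h) :
    Measurable fun w => histExp p (A.strategy w) i (F w) := by
  induction i with
  | zero => exact hF _
  | succ i ih =>
    refine ih fun h => ?_
    have := hp.comp (A.measurable_strategy (T := T) i h)
    exact (this.mul (hF _)).add ((measurable_const.sub this).mul (hF _))

lemma measurable_demand (m : Fin 4 → ℝ) : Measurable (demand m) := by
  have : demand m = (![∑ κ, m κ, m 1 + m 2 + m 3, m 2 + m 3, m 3] : Fin 4 → ℝ) ∘ ceilIdx :=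
    funext fun x => demand_eq m x
  rw [this]
  exact (measurable_of_countable _).comp measurable_ceilIdx

end measurability

/-! ### Round counts and the regret bound. -/

section regret

variable {lam : ℝ}

/-- For fixed seeds, the expected number of rounds in which the index of the chosen rate, rounded up
to the grid, lies in `s`. -/
def roundsGiven (lam ε : ℝ) (A : RandomizedAlgorithm) (T : ℕ) (s : Finset (Fin 4))
    (w : Fin T → unitInterval) : ℝ :=
  ∑ i ∈ Finset.range T, histExp (demand (mass lam ε)) (A.strategy w) i
    (fun h => if ceilIdx (A.strategy w i h) ∈ s then 1 else 0)

/-- The expected number of rounds in which the index of the chosen rate, rounded up to the grid,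
lies in `s`. -/
def rounds (lam ε : ℝ) (A : RandomizedAlgorithm) (T : ℕ) (s : Finset (Fin 4)) : ℝ :=
  ∫ w, roundsGiven lam ε A T s w ∂(seedLaw T)

lemma measurable_roundsGiven (lam ε : ℝ) (A : RandomizedAlgorithm) (T : ℕ) (s : Finset (Fin 4)) :
    Measurable (roundsGiven lam ε A T s) :=
  Finset.measurable_sum _ fun i _ => measurable_histExp A (measurable_demand _) i fun h =>
    (measurable_of_countable (fun j : Fin 4 => if j ∈ s then (1 : ℝ) else 0)).comp
      (measurable_ceilIdx.comp (A.measurable_strategy i h))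

lemma roundsGiven_add_compl (lam ε : ℝ) (A : RandomizedAlgorithm) (T : ℕ) (s : Finset (Fin 4))
    (w : Fin T → unitInterval) :
    roundsGiven lam ε A T s w + roundsGiven lam ε A T sᶜ w = T := by
  rw [roundsGiven, roundsGiven, ← Finset.sum_add_distrib]
  simp only [← histExp_add]
  rw [Finset.sum_congr rfl (g := fun _ => (1 : ℝ)), Finset.sum_const, Finset.card_range,
    nsmul_eq_mul, mul_one]
  intro i _
  rw [← histExp_const (p := demand (mass lam ε)) (act := A.strategy w) i 1]
  congr 1
  ext h
  rw [histExp_const]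
  by_cases hs : ceilIdx (A.strategy w i h) ∈ s <;> simp [hs]

lemma histExp_demand_mono (h0 : 0 < lam) (h1 : lam < 1) {ε : ℝ} (hε : ε ∈ Set.Icc (-1 : ℝ) 1)
    {act : (i : ℕ) → (Fin i → Bool) → unitInterval} (i : ℕ) {F G : (Fin i → Bool) → ℝ}
    (h : ∀ y, F y ≤ G y) :
    histExp (demand (mass lam ε)) act i F ≤ histExp (demand (mass lam ε)) act i G :=
  histExp_mono (demand_mass_nonneg h0 h1 hε) (demand_mass_le_one h0 h1 hε) i h

lemma histExp_demand_nonneg (h0 : 0 < lam) (h1 : lam < 1) {ε : ℝ} (hε : ε ∈ Set.Icc (-1 : ℝ) 1)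
    {act : (i : ℕ) → (Fin i → Bool) → unitInterval} (i : ℕ) {F : (Fin i → Bool) → ℝ}
    (h : ∀ y, 0 ≤ F y) : 0 ≤ histExp (demand (mass lam ε)) act i F := by
  rw [← histExp_const (p := demand (mass lam ε)) (act := act) i 0]
  exact histExp_demand_mono h0 h1 hε i h

lemma roundsGiven_nonneg (h0 : 0 < lam) (h1 : lam < 1) {ε : ℝ} (hε : ε ∈ Set.Icc (-1 : ℝ) 1)
    (A : RandomizedAlgorithm) (T : ℕ) (s : Finset (Fin 4)) (w : Fin T → unitInterval) :
    0 ≤ roundsGiven lam ε A T s w :=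
  Finset.sum_nonneg fun i _ => histExp_demand_nonneg h0 h1 hε i fun h => by split_ifs <;> simp

lemma integrable_roundsGiven (h0 : 0 < lam) (h1 : lam < 1) {ε : ℝ} (hε : ε ∈ Set.Icc (-1 : ℝ) 1)
    (A : RandomizedAlgorithm) (T : ℕ) (s : Finset (Fin 4)) :
    Integrable (roundsGiven lam ε A T s) (seedLaw T) := by
  refine Integrable.of_bound (measurable_roundsGiven lam ε A T s).aestronglyMeasurable T
    (Filter.Eventually.of_forall fun w => ?_)
  have e := roundsGiven_add_compl lam ε A T s w
  have := roundsGiven_nonneg h0 h1 hε A T s w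
  have := roundsGiven_nonneg h0 h1 hε A T sᶜ w
  rw [Real.norm_eq_abs, abs_le]
  constructor <;> linarith

lemma rounds_add_compl (h0 : 0 < lam) (h1 : lam < 1) {ε : ℝ} (hε : ε ∈ Set.Icc (-1 : ℝ) 1)
    (A : RandomizedAlgorithm) (T : ℕ) (s : Finset (Fin 4)) :
    rounds lam ε A T s + rounds lam ε A T sᶜ = T := by
  rw [rounds, rounds, ← integral_add (integrable_roundsGiven h0 h1 hε A T s)
    (integrable_roundsGiven h0 h1 hε A T sᶜ)]
  simp [roundsGiven_add_compl]

/-- Changing `ε` from zero affects the behaviour of the algorithm only as far as it chooses rates in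
`(1/2, 3/4]`. -/
lemma rounds_zero_le (h0 : 0 < lam) (h1 : lam < 1) {ε : ℝ} (hε : ε ∈ Set.Icc (-1 : ℝ) 1)
    (A : RandomizedAlgorithm) (T : ℕ) (s : Finset (Fin 4)) :
    rounds lam 0 A T s - T * (ε ^ 2 *
        (massB lam ^ 2 / (massA lam * (1 - massA lam - 2 * massB lam))) * rounds lam 0 A T {2})
      ≤ 2 * rounds lam ε A T s := by
  set K := ε ^ 2 * (massB lam ^ 2 / (massA lam * (1 - massA lam - 2 * massB lam))) with hK
  have hK0 : 0 ≤ K := by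
    have := massA_pos h0 h1
    have := mass_three_pos h0 h1
    positivity
  have hz : (0 : ℝ) ∈ Set.Icc (-1 : ℝ) 1 := by simp
  have i0 := integrable_roundsGiven h0 h1 hz A T s
  have i2 := (integrable_roundsGiven h0 h1 hz A T {2}).const_mul (T * K)
  rw [← mul_assoc]
  simp only [rounds]
  rw [← integral_const_mul, ← integral_const_mul, ← integral_sub i0 i2]
  refine integral_mono (i0.sub i2) ((integrable_roundsGiven h0 h1 hε A T s).const_mul 2)
    fun w => ?_
  -- The information gathered before any round is at most that of all `T` rounds; using this one
  -- budget in every round yields the factor `T`.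
  have hcost : ∀ i, i ≤ T → ∑ j ∈ Finset.range i, histExp (demand (mass lam 0)) (A.strategy w) j
      (fun h => infoCost lam ε (A.strategy w j h)) ≤ K * roundsGiven lam 0 A T {2} w := by
    intro i hi
    simp only [infoCost, ← hK, histExp_const_mul, ← Finset.mul_sum, roundsGiven,
      Finset.mem_singleton]
    refine mul_le_mul_of_nonneg_left ?_ hK0
    exact Finset.sum_le_sum_of_subset_of_nonneg (Finset.range_mono hi) fun j _ _ =>
      histExp_demand_nonneg h0 h1 hz j fun h => by split_ifs <;> simp
  have step : ∀ i ∈ Finset.range T,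
      histExp (demand (mass lam 0)) (A.strategy w) i
        (fun h => if ceilIdx (A.strategy w i h) ∈ s then (1 : ℝ) else 0)
      - K * roundsGiven lam 0 A T {2} w ≤ 2 * histExp (demand (mass lam ε)) (A.strategy w) i
        (fun h => if ceilIdx (A.strategy w i h) ∈ s then (1 : ℝ) else 0) := by
    intro i hi
    have := histExp_sub_le_two_mul (act := A.strategy w) (demand_mass_nonneg h0 h1 hz)
      (demand_mass_le_one h0 h1 hz) (demand_mass_nonneg h0 h1 hε) (demand_mass_le_one h0 h1 hε)
      (demand_mass_divergence h0 h1 hε) i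
      (F := fun h => if ceilIdx (A.strategy w i h) ∈ s then (1 : ℝ) else 0)
      (fun h => by split_ifs <;> simp) (fun h => by split_ifs <;> simp)
    have := hcost i (Finset.mem_range.1 hi).le
    linarith
  have := Finset.sum_le_sum step
  rw [Finset.sum_sub_distrib, Finset.sum_const, Finset.card_range,
    nsmul_eq_mul, ← mul_assoc, ← Finset.mul_sum] at this
  exact this

/-- The expected welfare gap relative to the rate `x`, when the law of the willingness to pay is
`fourPointLaw lam ε`. -/
def expectedGap (lam ε : ℝ) (A : RandomizedAlgorithm) (T : ℕ) (x : unitInterval) : ℝ :=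
  ∫ p : (Fin T → unitInterval) × (Fin T → unitInterval), welfareGap lam A x p.1 p.2
    ∂((seedLaw T).prod (Measure.pi (fun _ : Fin T => fourPointLaw lam ε)))

/-- Losses need to be checked only at grid rates, by `meanWelfare_le`. Outside `s` the hypothesis
only asks that the loss be nonnegative, so those rounds can be dropped. -/
lemma mul_rounds_le_expectedGap (h0 : 0 < lam) (h1 : lam < 1) {ε : ℝ}
    (hε : ε ∈ Set.Icc (-1 : ℝ) 1) (A : RandomizedAlgorithm) (T : ℕ) (s : Finset (Fin 4))
    {x : unitInterval} {d : ℝ}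
    (hd : ∀ j, d * (if j ∈ s then 1 else 0)
      ≤ meanWelfare lam (mass lam ε) x - meanWelfare lam (mass lam ε) (gridPoint j)) :
    d * rounds lam ε A T s ≤ expectedGap lam ε A T x := by
  have hm := mass_nonneg h0 h1 hε
  have := isProbabilityMeasure_fourPointLaw hm
  have hi := integrable_welfareGap h0.le h1.le A x
    ((seedLaw T).prod (Measure.pi (fun _ : Fin T => fourPointLaw lam ε)))
  rw [expectedGap, integral_prod _ hi, rounds, ← integral_const_mul]
  refine integral_mono ((integrable_roundsGiven h0 h1 hε A T s).const_mul d)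
    hi.integral_prod_left fun w => ?_
  simp only
  rw [integral_pi_fourPointLaw hm T (f := fun v => welfareGap lam A x w v)
    (measurable_welfareGap lam A x).of_uncurry_left, sum_prod_welfareGap (sum_mass ε) lam A x w]
  rw [roundsGiven, Finset.mul_sum]
  refine Finset.sum_le_sum fun i _ => ?_
  rw [← histExp_const_mul]
  refine histExp_demand_mono h0 h1 hε i fun h => (hd _).trans ?_
  have := meanWelfare_le h1.le hm (A.strategy w i h)
  linarith

/-- The rate of the lower bound. -/
def regretConst (lam : ℝ) : ℝ :=
  -- The first entry comes from `T/8` wrong rounds at loss `lam * massB lam / 4 * η`, the second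
  -- from many informative rounds at `ε = 0`.
  min (lam * massB lam / 32) (lam * massB lam / 4 *
    (1 / (4 * (massB lam ^ 2 / (massA lam * (1 - massA lam - 2 * massB lam))))))

lemma regretConst_pos (h0 : 0 < lam) (h1 : lam < 1) : 0 < regretConst lam := by
  have := massA_pos h0 h1
  have := massB_pos h0 h1
  have := mass_three_pos h0 h1
  refine lt_min ?_ ?_ <;> positivity

lemma exists_le_expectedGap (h0 : 0 < lam) (h1 : lam < 1) (A : RandomizedAlgorithm) (T : ℕ) :
    ∃ ε ∈ Set.Icc (-1 : ℝ) 1, ∃ x ∈ grid,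
      regretConst lam * (T : ℝ) ^ (2 / 3 : ℝ) ≤ expectedGap lam ε A T x := by
  have ha := massA_pos h0 h1
  have hb := massB_pos h0 h1
  have hc := mass_three_pos h0 h1
  set K := massB lam ^ 2 / (massA lam * (1 - massA lam - 2 * massB lam)) with hK
  have hK0 : 0 < K := by positivity
  have hδ : 0 < lam * massB lam / 4 := by positivity
  have hz : (0 : ℝ) ∈ Set.Icc (-1 : ℝ) 1 := by simp
  have hT0 : 0 ≤ (T : ℝ) ^ (2 / 3 : ℝ) := by positivity
  by_cases hn : 1 / (4 * K) * (T : ℝ) ^ (2 / 3 : ℝ) ≤ rounds lam 0 A T {2}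
  · refine ⟨0, hz, gridPoint 3, gridPoint_mem 3, ?_⟩
    have key := mul_rounds_le_expectedGap h0 h1 hz A T {2} (x := gridPoint 3)
      (d := lam * massB lam / 4) (fun j => by
        refine le_trans ?_ (meanWelfare_mass h0 h1 hz j)
        fin_cases j <;> simp; positivity)
    refine le_trans ?_ key
    calc regretConst lam * (T : ℝ) ^ (2 / 3 : ℝ)
        ≤ lam * massB lam / 4 * (1 / (4 * K)) * (T : ℝ) ^ (2 / 3 : ℝ) :=
          mul_le_mul_of_nonneg_right (min_le_right _ _) hT0
      _ ≤ _ := by rw [mul_assoc]; gcongr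
  -- For `T = 0` both sides of the case condition vanish, so the first case applies.
  · have hT : 0 < T := by
      rcases Nat.eq_zero_or_pos T with rfl | h
      · exfalso
        apply hn
        simp [rounds, roundsGiven]
      · exact h
    have hTr : (1 : ℝ) ≤ T := by exact_mod_cast hT
    have hTp : (0 : ℝ) < T := by linarith
    -- This exponent balances the two demands: `η² T^(2/3) = 1` keeps the information bounded, and
    -- `η T = T^(2/3)` is the resulting regret.
    set η := (T : ℝ) ^ (-(1 / 3) : ℝ) with hη
    have hη0 : 0 < η := Real.rpow_pos_of_pos hTp _
    have hη1 : η ≤ 1 := Real.rpow_le_one_of_one_le_of_nonpos hTr (by norm_num)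
    have hηT : η * T = (T : ℝ) ^ (2 / 3 : ℝ) := by
      rw [hη, ← Real.rpow_add_one hTp.ne']; norm_num
    have hη2 : η ^ 2 * (T : ℝ) ^ (2 / 3 : ℝ) = 1 := by
      rw [hη, ← Real.rpow_natCast, ← Real.rpow_mul hTp.le, ← Real.rpow_add hTp]; norm_num
    have hinfo : (T : ℝ) * (η ^ 2 * K * rounds lam 0 A T {2}) ≤ T / 4 := by
      have : η ^ 2 * K * rounds lam 0 A T {2}
          ≤ η ^ 2 * K * (1 / (4 * K) * (T : ℝ) ^ (2 / 3 : ℝ)) := by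
        have := (not_le.1 hn).le
        gcongr
      have e : η ^ 2 * K * (1 / (4 * K) * (T : ℝ) ^ (2 / 3 : ℝ)) = 1 / 4 := by
        rw [show η ^ 2 * K * (1 / (4 * K) * (T : ℝ) ^ (2 / 3 : ℝ))
          = η ^ 2 * (T : ℝ) ^ (2 / 3 : ℝ) * (K / (4 * K)) by ring, hη2]
        field_simp
      rw [e] at this
      nlinarith
    have hfin : ∀ n : ℝ, (T : ℝ) / 8 ≤ n →
        regretConst lam * (T : ℝ) ^ (2 / 3 : ℝ) ≤ lam * massB lam / 4 * η * n := by
      intro n hn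
      calc regretConst lam * (T : ℝ) ^ (2 / 3 : ℝ)
          ≤ lam * massB lam / 32 * (T : ℝ) ^ (2 / 3 : ℝ) :=
            mul_le_mul_of_nonneg_right (min_le_left _ _) hT0
        _ = lam * massB lam / 4 * η * (T / 8) := by rw [← hηT]; ring
        _ ≤ _ := by gcongr
    -- Under `ε = 0` either index `3` or its complement occupies at least `T/2` expected rounds. The
    -- sign of `ε` is chosen to make that choice wrong; the change of measure leaves `(T/2 - T/4) /
    -- 2 = T/8`.
    have hsum := rounds_add_compl h0 h1 hz A T {3}
    rcases le_total (rounds lam 0 A T {3}) (rounds lam 0 A T {3}ᶜ) with h | h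
    · have hε : η ∈ Set.Icc (-1 : ℝ) 1 := ⟨by linarith, hη1⟩
      refine ⟨η, hε, gridPoint 3, gridPoint_mem 3, ?_⟩
      have key := mul_rounds_le_expectedGap h0 h1 hε A T {3}ᶜ (x := gridPoint 3)
        (d := lam * massB lam / 4 * η) (fun j => by
          refine le_trans ?_ (meanWelfare_mass h0 h1 hε j)
          fin_cases j <;> simp <;> exact mul_le_of_le_one_right hδ.le hη1)
      have := rounds_zero_le h0 h1 hε A T {3}ᶜ
      exact (hfin _ (by linarith)).trans key
    · have hε : -η ∈ Set.Icc (-1 : ℝ) 1 := ⟨by linarith, by linarith⟩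
      refine ⟨-η, hε, gridPoint 0, gridPoint_mem 0, ?_⟩
      have key := mul_rounds_le_expectedGap h0 h1 hε A T {3} (x := gridPoint 0)
        (d := lam * massB lam / 4 * η) (fun j => by
          have e0 := meanWelfare_mass_sub h0 h1 (-η)
          have ej := meanWelfare_mass h0 h1 hε j
          have hη' := mul_pos hδ hη0
          fin_cases j <;> simp at e0 ej ⊢ <;> linarith)
      have := rounds_zero_le h0 h1 hε A T {3}
      rw [neg_sq] at this
      exact (hfin _ (by linarith)).trans key

/-- By Fubini the expected gap is a weighted average over the finitely many grid sequences, hence at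
most its maximum. The rate `x` is fixed beforehand, so no supremum has to be exchanged with the
average. -/
lemma exists_le_integral_seeds (h0 : 0 < lam) (h1 : lam < 1) {ε : ℝ}
    (hε : ε ∈ Set.Icc (-1 : ℝ) 1) (A : RandomizedAlgorithm) (T : ℕ) (x : unitInterval) :
    ∃ k : Fin T → Fin 4,
      expectedGap lam ε A T x ≤ ∫ w, welfareGap lam A x w (fun j => gridPoint (k j)) ∂(seedLaw T) := by
  have hm := mass_nonneg h0 h1 hε
  have := isProbabilityMeasure_fourPointLaw hm
  have hi := integrable_welfareGap h0.le h1.le A x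
    ((seedLaw T).prod (Measure.pi (fun _ : Fin T => fourPointLaw lam ε)))
  have hmeas : Measurable fun v => ∫ w, welfareGap lam A x w v ∂(seedLaw T) :=
    ((measurable_welfareGap lam A x).stronglyMeasurable.integral_prod_left
      (μ := seedLaw T)).measurable
  obtain ⟨k, -, hk⟩ := Finset.exists_max_image Finset.univ (fun k : Fin T → Fin 4 =>
    ∫ w, welfareGap lam A x w (fun j => gridPoint (k j)) ∂(seedLaw T)) Finset.univ_nonempty
  refine ⟨k, ?_⟩
  have hone : ∑ k : Fin T → Fin 4, ∏ j, mass lam ε (k j) = 1 := by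
    simpa [histExp_const] using
      sum_prod_history (sum_mass (lam := lam) ε) (A.strategy (fun _ : Fin T => 0)) T fun _ => 1
  rw [expectedGap, integral_prod_symm _ hi, integral_pi_fourPointLaw hm T hmeas]
  refine (Finset.sum_le_sum fun k' _ => mul_le_mul_of_nonneg_left (hk k' (Finset.mem_univ _))
    (Finset.prod_nonneg fun j _ => hm (k' j))).trans_eq ?_
  rw [← Finset.sum_mul, hone, one_mul]

lemma le_stochasticRegret (h0 : 0 < lam) (h1 : lam < 1) {ε : ℝ}
    (hε : ε ∈ Set.Icc (-1 : ℝ) 1) (A : RandomizedAlgorithm) (T : ℕ) {X : Set unitInterval}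
    {x : unitInterval} (hx : x ∈ X) :
    expectedGap lam ε A T x ≤ stochasticRegret lam A T (fourPointLaw lam ε) X := by
  have := isProbabilityMeasure_fourPointLaw (mass_nonneg h0 h1 hε)
  -- The bound `4 * T` is essential: a real supremum dominates its members only when the family is
  -- bounded above.
  refine le_ciSup (f := fun x : X => expectedGap lam ε A T x) ⟨4 * T, ?_⟩ ⟨x, hx⟩
  rintro _ ⟨y, rfl⟩
  refine (le_abs_self _).trans ?_
  have := norm_integral_le_of_norm_le_const
    (μ := (seedLaw T).prod (Measure.pi (fun _ : Fin T => fourPointLaw lam ε)))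
    (f := fun p => welfareGap lam A y.1 p.1 p.2) (C := 4 * T)
    (Filter.Eventually.of_forall fun p => abs_welfareGap_le h0.le h1.le A y.1 p.1 p.2)
  simpa [expectedGap] using this

lemma le_adversarialRegret (h0 : 0 < lam) (h1 : lam < 1) (A : RandomizedAlgorithm) {T : ℕ}
    (v : Fin T → unitInterval) {X : Set unitInterval} {x : unitInterval} (hx : x ∈ X) :
    ∫ w, welfareGap lam A x w v ∂(seedLaw T) ≤ adversarialRegret lam A v X := by
  refine le_ciSup (f := fun x : X => ∫ w, welfareGap lam A x w v ∂(seedLaw T)) ⟨4 * T, ?_⟩ ⟨x, hx⟩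
  rintro _ ⟨y, rfl⟩
  refine (le_abs_self _).trans ?_
  have := norm_integral_le_of_norm_le_const (μ := seedLaw T)
    (f := fun w => welfareGap lam A y.1 w v) (C := 4 * T)
    (Filter.Eventually.of_forall fun w => abs_welfareGap_le h0.le h1.le A y.1 w v)
  simpa using this

end regret

end OptimalTax

end

theorem theorem1 (lam : ℝ) (hlam0 : 0 < lam) (hlam1 : lam < 1) :
    ∃ C : ℝ, 0 < C ∧ ∀ (A : OptimalTax.RandomizedAlgorithm) (T : ℕ),
      (∃ μ : MeasureTheory.Measure unitInterval, MeasureTheory.IsProbabilityMeasure μ ∧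
        (∃ ε ∈ Set.Icc (-1 : ℝ) 1, μ = OptimalTax.fourPointLaw lam ε) ∧
        C * (T : ℝ) ^ (2 / 3 : ℝ) ≤ OptimalTax.stochasticRegret lam A T μ Set.univ ∧
        C * (T : ℝ) ^ (2 / 3 : ℝ) ≤ OptimalTax.stochasticRegret lam A T μ OptimalTax.grid) ∧
      (∃ v : Fin T → unitInterval, (∀ i, v i ∈ OptimalTax.grid) ∧
        C * (T : ℝ) ^ (2 / 3 : ℝ) ≤ OptimalTax.adversarialRegret lam A v Set.univ ∧
        C * (T : ℝ) ^ (2 / 3 : ℝ) ≤ OptimalTax.adversarialRegret lam A v OptimalTax.grid) := by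
  refine ⟨OptimalTax.regretConst lam, OptimalTax.regretConst_pos hlam0 hlam1, fun A T => ?_⟩
  obtain ⟨ε, hε, x, hx, h⟩ := OptimalTax.exists_le_expectedGap hlam0 hlam1 A T
  obtain ⟨k, hk⟩ := OptimalTax.exists_le_integral_seeds hlam0 hlam1 hε A T x
  refine ⟨⟨OptimalTax.fourPointLaw lam ε, OptimalTax.isProbabilityMeasure_fourPointLaw
      (OptimalTax.mass_nonneg hlam0 hlam1 hε), ⟨ε, hε, rfl⟩,
      h.trans (OptimalTax.le_stochasticRegret hlam0 hlam1 hε A T (Set.mem_univ x)),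
      h.trans (OptimalTax.le_stochasticRegret hlam0 hlam1 hε A T hx)⟩,
    ⟨fun j => OptimalTax.gridPoint (k j), fun i => OptimalTax.gridPoint_mem _,
      (h.trans hk).trans (OptimalTax.le_adversarialRegret hlam0 hlam1 A _ (Set.mem_univ x)),
      (h.trans hk).trans (OptimalTax.le_adversarialRegret hlam0 hlam1 A _ hx)⟩⟩
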